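/- Let $\alpha,\beta,\kappa\in\mathbb R$ with $-1<\alpha\le\beta$ and $\kappa\ge 1$. Let $$w(x)=2^{-\alpha-\beta-1}\frac{\Gamma(\alpha+\beta+2)}{\Gamma(\alpha+1)\Gamma(\beta+1)}(1-x)^\alpha(1+x)^\beta,\qquad \langle f,g\rangle=\int_{-1}^1 f(x)\overline{g(x)}\,w(x)\,dx,$$ $\mathcal H=L^2((-1,1),w(x)dx)$ and $D=\dfrac{4\Gamma(\alpha+\beta+2)}{\Gamma(\alpha+1)\Gamma(\beta+1)}$. With principal square roots put $\delta(\lambda)=\sqrt{\lambda+(\alpha+1)^2}$ and $\eta(\lambda)=\sqrt{\lambda+(\beta+1)^2}$. For $n\in\mathbb N=\{0,1,2,\dots\}$ let $\lambda_n\in\mathbb C$ denote a solution, different from $-(\alpha+1)^2$, of $$\delta(\lambda)+\eta(\lambda)=\kappa-2n-1 .$$ Such a solution exists if and only if $\kappa-2n-1>\sqrt{(\beta-\alpha)(\alpha+\beta+2)}$ (in particular $n\le\frac12(\kappa-1)$), and it is then unique, real, and given by $$\lambda_n=\Big(-n+\tfrac12(\kappa-1)+\frac{(\alpha-\beta)(\alpha+\beta+2)}{-4n-2+2\kappa}\Big)^2-(\alpha+1)^2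 .$$ For such $n$ and $x\in(-1,1)$ define $$F_n(x)={}_2F_1\Big({-n},\kappa-n;1+\eta(\lambda_n);\tfrac{1+x}2\Big),$$ $$\varphi_{\lambda_n}(x)=\Big(\frac{1-x}2\Big)^{-\frac12(\alpha-\delta(\lambda_n)+1)}\Big(\frac{1+x}2\Big)^{-\frac12(\beta-\eta(\lambda_n)+1)}F_n(x),$$ $$N_{\lambda_n}=\frac{4\delta(\lambda_n)}{\kappa-2n-1}\cdot\frac{(1+\eta(\lambda_n))_n\,\Gamma(\kappa-n)}{n!\,\Gamma(\eta(\lambda_n))\,\Gamma\big(\frac12(1+\delta(\lambda_n)-\eta(\lambda_n)+\kappa)\big)},$$ where $(a)_n=a(a+1)\cdots(a+n-1)$. If $\eta(\lambda_n)$ is not an integer, then the function below has at most a simple pole at $\lambda_n$ and $$N_{\lambda_n}=\operatorname*{Res}_{\lambda=\lambda_n}\frac{c(\eta(\lambda);\delta(\lambda))}{\eta(\lambda)\,c(-\eta(\lambda);\delta(\lambda))},\qquad c(x;y)=\frac{\Gamma(1+y)\Gamma(-x)}{\Gamma(\frac12(1+y-x+\kappa))\Gamma(\frac12(1+y-x-\kappa))},$$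 $$N_{\lambda_n}=\frac{4\delta(\lambda_n)}{\kappa-2n-1}\cdot\frac{(-1)^n\,\Gamma(-\eta(\lambda_n))\,\Gamma(\kappa-n)}{n!\,\Gamma(\eta(\lambda_n))\,\Gamma\big(\frac12(1+\delta(\lambda_n)-\eta(\lambda_n)+\kappa)\big)\,\Gamma\big(\frac12(1+\delta(\lambda_n)-\eta(\lambda_n)-\kappa)\big)}.$$ Then for all $m,n\in\mathbb N$ with $m,n\le\frac12(\kappa-1)$ for which $\lambda_m$ and $\lambda_n$ exist, the functions $\varphi_{\lambda_m},\varphi_{\lambda_n}$ belong to $\mathcal H$ and $$\langle\varphi_{\lambda_m},\varphi_{\lambda_n}\rangle=\delta_{mn}\frac{D}{N_{\lambda_n}};$$ written out (the integral being absolutely convergent), $$\int_{-1}^1F_m(x)F_n(x)\,(1-x)^{\frac12(\delta(\lambda_m)+\delta(\lambda_n)-2)}(1+x)^{\frac12(\eta(\lambda_m)+\eta(\lambda_n)-2)}\,dx=\delta_{mn}\frac{2^{\kappa-n-m}}{N_{\lambda_n}} .$$ -/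

import Mathlib

open MeasureTheory Set Filter Topology

noncomputable section

/-- The normalized Jacobi weight
`2^(-α-β-1) Γ(α+β+2) / (Γ(α+1) Γ(β+1)) (1-x)^α (1+x)^β`. -/
def jacobiWeight (α β x : ℝ) : ℝ :=
  (2 : ℝ) ^ (-α - β - 1) * (Real.Gamma (α + β + 2) / (Real.Gamma (α + 1) * Real.Gamma (β + 1))) *
    (1 - x) ^ α * (1 + x) ^ β

/-- The measure `w(x) dx` on `(-1,1)`; the Hilbert space `H` is the `L²`-space of this measure. -/
def jacobiMeasure (α β : ℝ) : Measure ℝ :=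
  (volume.restrict (Ioo (-1 : ℝ) 1)).withDensity fun x => ENNReal.ofReal (jacobiWeight α β x)

/-- The inner product `⟨f, g⟩ = ∫_{-1}^1 f(x) conj(g(x)) w(x) dx` of `H`. -/
def jacobiInner (α β : ℝ) (f g : ℝ → ℂ) : ℂ :=
  ∫ x in (-1 : ℝ)..1, f x * (starRingEnd ℂ) (g x) * (jacobiWeight α β x : ℂ)

/-- `δ(z) = √(z + (α+1)²)`, principal branch. -/
def deltaFn (α : ℝ) (z : ℂ) : ℂ := Complex.sqrt (z + ((α : ℂ) + 1) ^ 2)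

/-- `η(z) = √(z + (β+1)²)`, principal branch. -/
def etaFn (β : ℝ) (z : ℂ) : ℂ := Complex.sqrt (z + ((β : ℂ) + 1) ^ 2)

/-- `z` is a solution `λ_n` of the equation `δ(z) + η(z) = -2n - 1 + κ`. -/
def IsLambda (α β κ : ℝ) (n : ℕ) (z : ℂ) : Prop :=
  deltaFn α z + etaFn β z = -2 * (n : ℂ) - 1 + (κ : ℂ)

/-- `c(x;y) = Γ(1+y) Γ(-x) / (Γ((1+y-x+κ)/2) Γ((1+y-x-κ)/2))`. -/
def cFn (κ : ℝ) (x y : ℂ) : ℂ :=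
  Complex.Gamma (1 + y) * Complex.Gamma (-x) /
    (Complex.Gamma ((1 + y - x + κ) / 2) * Complex.Gamma ((1 + y - x - κ) / 2))

/-- The function `z ↦ c(η(z); δ(z)) / (η(z) c(-η(z); δ(z)))`. -/
def cQuotient (α β κ : ℝ) (z : ℂ) : ℂ :=
  cFn κ (etaFn β z) (deltaFn α z) / (etaFn β z * cFn κ (-etaFn β z) (deltaFn α z))

/-- `f` is meromorphic at `z₀`, has at most a simple pole there, and its residue is `r`. -/
def HasSimpleResidue (f : ℂ → ℂ) (z₀ r : ℂ) : Prop :=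
  MeromorphicAt f z₀ ∧ Tendsto (fun z => (z - z₀) * f z) (𝓝[≠] z₀) (𝓝 r)

/-- The expression for `N_{λ_n}` as a quotient of Gamma functions, with `z = λ_n`:
`4δ(z)/(κ-2n-1) · (-1)^n Γ(-η(z)) Γ(κ-n) / (n! Γ(η(z)) Γ((1+δ(z)-η(z)+κ)/2) Γ((1+δ(z)-η(z)-κ)/2))`.
It has the form `∞/∞` when `η(z)` is a positive integer. -/
def normConstGamma (α β κ : ℝ) (n : ℕ) (z : ℂ) : ℂ :=
  4 * deltaFn α z / (-2 * (n : ℂ) - 1 + κ) *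
    ((-1) ^ n * (Complex.Gamma (-etaFn β z) * Complex.Gamma ((κ : ℂ) - n)) /
      ((n.factorial : ℂ) *
        (Complex.Gamma (etaFn β z) * Complex.Gamma ((1 + deltaFn α z - etaFn β z + κ) / 2) *
          Complex.Gamma ((1 + deltaFn α z - etaFn β z - κ) / 2))))

/-- The constant `N_{λ_n}`, with `z = λ_n`. Since `(1+δ(z)-η(z)-κ)/2 = -η(z)-n` at `z = λ_n`, the
factor `(-1)^n Γ(-η(z)) / Γ((1+δ(z)-η(z)-κ)/2)` of `normConstGamma` is the shifted factorial
`(1+η(z))_n`; written in this way the constant also makes sense when `η(z)` is an integer. -/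
def normConst (α β κ : ℝ) (n : ℕ) (z : ℂ) : ℂ :=
  4 * deltaFn α z / (-2 * (n : ℂ) - 1 + κ) *
    ((ascPochhammer ℂ n).eval (1 + etaFn β z) * Complex.Gamma ((κ : ℂ) - n) /
      ((n.factorial : ℂ) *
        (Complex.Gamma (etaFn β z) * Complex.Gamma ((1 + deltaFn α z - etaFn β z + κ) / 2))))

/-- `D = 4 Γ(α+β+2) / (Γ(α+1) Γ(β+1))`. -/
def constD (α β : ℝ) : ℝ :=
  4 * Real.Gamma (α + β + 2) / (Real.Gamma (α + 1) * Real.Gamma (β + 1))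

/-- The terminating series `₂F₁(-n, κ-n; 1+η(z); (1+x)/2)`. -/
def hypPoly (β κ : ℝ) (n : ℕ) (z : ℂ) (x : ℝ) : ℂ :=
  ordinaryHypergeometric (-(n : ℂ)) ((κ : ℂ) - n) (1 + etaFn β z) ((1 + (x : ℂ)) / 2)

/-- The function `φ_{λ_n}` on `(-1,1)`, with `z = λ_n`. -/
def phi (α β κ : ℝ) (n : ℕ) (z : ℂ) (x : ℝ) : ℂ :=
  ((1 - (x : ℂ)) / 2) ^ (-((α : ℂ) - deltaFn α z + 1) / 2) *
    ((1 + (x : ℂ)) / 2) ^ (-((β : ℂ) - etaFn β z + 1) / 2) * hypPoly β κ n z x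

/-- The integrand of the orthogonality relations written out, with `z = λ_m` and `u = λ_n`. -/
def orthIntegrand (α β κ : ℝ) (m n : ℕ) (z u : ℂ) (x : ℝ) : ℂ :=
  hypPoly β κ m z x * hypPoly β κ n u x *
    (1 - (x : ℂ)) ^ ((deltaFn α z + deltaFn α u - 2) / 2) *
    (1 + (x : ℂ)) ^ ((etaFn β z + etaFn β u - 2) / 2)

end

/-! Write d = δ(λ_n) and e = η(λ_n). Both are positive reals with d + e = κ - 2n - 1 and e² - d² =
(β-α)(α+β+2). Under t = (1+x)/2 both forms of the orthogonality relation become the integral of P·P'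
against t^((e+e')/2-1) (1-t)^((d+d')/2-1), where P = ₂F₁(-m, m+e+d+1; 1+e; t) is a Jacobi polynomial
whose parameters vary with the index, and P' is its analogue for n, e', d'.

Off the diagonal, t^(e/2) (1-t)^(d/2) P solves a Sturm-Liouville equation in which d and e enter
only through e² - d² and d + e + 2m = κ - 1, which are shared, and through the eigenvalue e²/4. The
Wronskian identity then gives orthogonality (`betaMoment_jacobiPolynomial_mul_eq_zero`).

On the diagonal the weight t^(e-1) (1-t)^(d-1) is one power short, in each factor, of the weight for
which P is orthogonal to lower degrees. An integration by parts, 1 = t + (1-t) and P(0) = 1 reduce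
the norm to a single integral of P, which a Rodrigues-type recurrence evaluates
(`betaMoment_jacobiPolynomial`, `betaMoment_jacobiPolynomial_sq`).

The residue comes from one Gamma factor, Γ((1+δ+η-κ)/2), whose argument passes through -n with
nonzero derivative at λ_n. -/

/-! ### Polynomial moments of the beta weight -/

open Polynomial in
/-- The integral of a polynomial against the beta weight `t^(p-1) (1-t)^(q-1)` on `(0,1)`. -/
noncomputable def betaMoment (p q : ℝ) (Q : ℝ[X]) : ℝ :=
  ∫ t in (0 : ℝ)..1, t ^ (p - 1) * (1 - t) ^ (q - 1) * Q.eval t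

section BetaMoment

open Polynomial

variable {p q : ℝ}

theorem intervalIntegrable_betaWeight (hp : 0 < p) (hq : 0 < q) :
    IntervalIntegrable (fun t : ℝ => t ^ (p - 1) * (1 - t) ^ (q - 1)) volume 0 1 := by
  have h := (Complex.betaIntegral_convergent (u := p) (v := q) (by simpa) (by simpa)).norm
  rw [intervalIntegrable_iff_integrableOn_Ioo_of_le zero_le_one] at h ⊢
  refine h.congr_fun (fun t ht => ?_) measurableSet_Ioo
  have h0 : (0 : ℝ) < 1 - t := by linarith [ht.2]
  have e : (1 - (t : ℂ)) = ((1 - t : ℝ) : ℂ) := by push_cast; rfl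
  change ‖(t : ℂ) ^ ((p : ℂ) - 1) * (1 - (t : ℂ)) ^ ((q : ℂ) - 1)‖ = _
  rw [norm_mul, e, Complex.norm_cpow_eq_rpow_re_of_pos ht.1,
    Complex.norm_cpow_eq_rpow_re_of_pos h0]
  simp

theorem intervalIntegrable_betaWeight_mul_eval (hp : 0 < p) (hq : 0 < q) (Q : ℝ[X]) :
    IntervalIntegrable (fun t : ℝ => t ^ (p - 1) * (1 - t) ^ (q - 1) * Q.eval t) volume 0 1 :=
  (intervalIntegrable_betaWeight hp hq).mul_continuousOn Q.continuous.continuousOn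

theorem betaMoment_add (hp : 0 < p) (hq : 0 < q) (Q R : ℝ[X]) :
    betaMoment p q (Q + R) = betaMoment p q Q + betaMoment p q R := by
  simp only [betaMoment, eval_add, mul_add]
  exact intervalIntegral.integral_add (intervalIntegrable_betaWeight_mul_eval hp hq Q)
    (intervalIntegrable_betaWeight_mul_eval hp hq R)

theorem betaMoment_C_mul (c : ℝ) (Q : ℝ[X]) :
    betaMoment p q (C c * Q) = c * betaMoment p q Q := by
  simp only [betaMoment, eval_mul, eval_C]
  rw [← intervalIntegral.integral_const_mul]
  congr 1; ext t; ring

theorem betaMoment_X_mul (Q : ℝ[X]) : betaMoment p q (X * Q) = betaMoment (p + 1) q Q := by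
  refine intervalIntegral.integral_congr_ae (Eventually.of_forall fun t ht => ?_)
  rw [uIoc_of_le zero_le_one] at ht
  rw [show p + 1 - 1 = p - 1 + 1 by ring, Real.rpow_add_one ht.1.ne', eval_mul, eval_X]
  ring

theorem betaMoment_one_sub_X_mul (Q : ℝ[X]) :
    betaMoment p q ((1 - X) * Q) = betaMoment p (q + 1) Q := by
  refine intervalIntegral.integral_congr_ae ?_
  -- At t = 1 the rule 0^q = 0^(q-1)·0 can fail for the conventional values of `rpow`, so this point
  -- is discarded.
  filter_upwards [compl_mem_ae_iff.mpr (measure_singleton (μ := volume) (1 : ℝ))] with t ht1 ht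
  rw [uIoc_of_le zero_le_one] at ht
  have h0 : (1 - t) ≠ 0 := sub_ne_zero.mpr (Ne.symm ht1)
  rw [show q + 1 - 1 = q - 1 + 1 by ring, Real.rpow_add_one h0, eval_mul, eval_sub, eval_X,
    eval_one]
  ring

theorem betaMoment_one (hp : 0 < p) (hq : 0 < q) :
    betaMoment p q 1 = Real.Gamma p * Real.Gamma q / Real.Gamma (p + q) := by
  have h := ProbabilityTheory.beta_eq_betaIntegralReal p q hp hq
  rw [ProbabilityTheory.beta] at h
  rw [h, betaMoment, ← Complex.ofReal_re (∫ t in (0 : ℝ)..1, _), ← intervalIntegral.integral_ofReal,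
    Complex.betaIntegral]
  congr 1
  refine intervalIntegral.integral_congr_ae (Eventually.of_forall fun t ht => ?_)
  rw [uIoc_of_le zero_le_one] at ht
  have h0 : (0 : ℝ) ≤ 1 - t := by linarith [ht.2]
  push_cast [Complex.ofReal_cpow ht.1.le, Complex.ofReal_cpow h0]
  simp

/-- Integration by parts: the derivative of `t^p (1-t)^q Q(t)` has integral zero. -/
theorem betaMoment_derivative (hp : 0 < p) (hq : 0 < q) (Q : ℝ[X]) :
    betaMoment p q ((C p * (1 - X) - C q * X) * Q + X * (1 - X) * derivative Q) = 0 := by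
  have h := intervalIntegral.integral_eq_sub_of_hasDerivAt_of_le (zero_le_one' ℝ)
    (f := fun t : ℝ => t ^ p * (1 - t) ^ q * Q.eval t)
    (f' := fun t : ℝ => t ^ (p - 1) * (1 - t) ^ (q - 1) *
      ((C p * (1 - X) - C q * X) * Q + X * (1 - X) * derivative Q).eval t) ?_ ?_
      (intervalIntegrable_betaWeight_mul_eval hp hq _)
  · rw [betaMoment, h]
    simp [Real.zero_rpow hp.ne', Real.zero_rpow hq.ne']
  · refine ((ContinuousOn.rpow_const continuousOn_id fun _ _ => Or.inr hp.le).mul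
      (ContinuousOn.rpow_const (by fun_prop) fun _ _ => Or.inr hq.le)).mul Q.continuous.continuousOn
  · intro t ht
    have h0 : (0 : ℝ) < 1 - t := by linarith [ht.2]
    have d1 := Real.hasDerivAt_rpow_const (x := t) (p := p) (Or.inl ht.1.ne')
    have d2 := (((hasDerivAt_id t).const_sub 1).rpow_const (p := q) (Or.inl h0.ne'))
    refine ((d1.mul d2).mul (Q.hasDerivAt t)).congr_deriv ?_
    have e1 : t ^ p = t ^ (p - 1) * t := by
      rw [← Real.rpow_add_one ht.1.ne']; congr 1; ring
    have e2 : (1 - t) ^ q = (1 - t) ^ (q - 1) * (1 - t) := by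
      rw [← Real.rpow_add_one h0.ne']; congr 1; ring
    simp only [id, Pi.mul_apply, e1, e2, eval_add, eval_mul, eval_sub, eval_C, eval_X, eval_one]
    ring

end BetaMoment

/-! ### Jacobi polynomials: recurrences, moments, norms, orthogonality across parameters -/

section JacobiPolynomial

open Polynomial

/-- The polynomial `₂F₁(-n, n + a + b + 1; 1 + a; X)`, a Jacobi polynomial on `(0,1)` normalized to
have the value `1` at `0`. -/
noncomputable def jacobiPolynomial (n : ℕ) (a b : ℝ) : ℝ[X] :=
  ∑ k ∈ Finset.range (n + 1),
    C (ordinaryHypergeometricCoefficient (-(n : ℝ)) (n + a + b + 1) (1 + a) k) * X ^ k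

variable {a b : ℝ}

theorem coeff_jacobiPolynomial (n : ℕ) (a b : ℝ) (k : ℕ) : (jacobiPolynomial n a b).coeff k =
    ordinaryHypergeometricCoefficient (-(n : ℝ)) (n + a + b + 1) (1 + a) k := by
  simp only [jacobiPolynomial, finsetSum_coeff, coeff_C_mul, coeff_X_pow, mul_ite, mul_one,
    mul_zero, Finset.sum_ite_eq, Finset.mem_range]
  split_ifs with h
  · rfl
  · have : (ascPochhammer ℝ k).eval (-(n : ℝ)) = 0 :=
      (ascPochhammer_eval_eq_zero_iff k _).2 ⟨n, by omega, by simp⟩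
    simp [ordinaryHypergeometricCoefficient, this]

theorem ascPochhammer_eval_ne_zero_of_pos {x : ℝ} (hx : 0 < x) (k : ℕ) :
    (ascPochhammer ℝ k).eval x ≠ 0 := (ascPochhammer_pos k x hx).ne'

theorem ascPochhammer_succ_eval_left (k : ℕ) (x : ℝ) :
    (ascPochhammer ℝ (k + 1)).eval x = x * (ascPochhammer ℝ k).eval (x + 1) := by
  simp [ascPochhammer_succ_left]

theorem coeff_jacobiPolynomial_succ (ha : -1 < a) (n k : ℕ) :
    (k + 1) * (1 + a + k) * (jacobiPolynomial n a b).coeff (k + 1) =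
      (k - n) * (n + a + b + 1 + k) * (jacobiPolynomial n a b).coeff k := by
  have h1 := ascPochhammer_eval_ne_zero_of_pos (show 0 < 1 + a by linarith) k
  have h2 : 1 + a + k ≠ 0 := by
    have := k.cast_nonneg (α := ℝ)
    linarith
  simp only [coeff_jacobiPolynomial, ordinaryHypergeometricCoefficient, ascPochhammer_succ_eval,
    Nat.factorial_succ]
  push_cast
  field_simp
  ring

theorem derivative_jacobiPolynomial_succ (ha : -1 < a) (n : ℕ) :
    C (1 + a) * derivative (jacobiPolynomial (n + 1) a b) =
      C (-((n + 1) * (n + a + b + 2))) * jacobiPolynomial n (a + 1) (b + 1) := by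
  ext k
  have h1 := ascPochhammer_eval_ne_zero_of_pos (show 0 < 1 + a + 1 by linarith) k
  have h2 : 1 + a ≠ 0 := by linarith
  rw [coeff_C_mul, coeff_C_mul, coeff_derivative, coeff_jacobiPolynomial, coeff_jacobiPolynomial]
  simp only [ordinaryHypergeometricCoefficient, ascPochhammer_succ_eval_left, Nat.factorial_succ]
  push_cast
  rw [show (-((n : ℝ) + 1) + 1) = -n by ring, show (n : ℝ) + 1 + a + b + 1 + 1 =
    n + (a + 1) + (b + 1) + 1 by ring, show 1 + (a + 1) = 1 + a + 1 by ring]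
  field_simp
  ring

/-- The hypergeometric differential equation. -/
theorem jacobiPolynomial_ode (ha : -1 < a) (n : ℕ) :
    X * (1 - X) * derivative (derivative (jacobiPolynomial n a b)) +
      (C (1 + a) - C (a + b + 2) * X) * derivative (jacobiPolynomial n a b) +
      C (n * (n + a + b + 1)) * jacobiPolynomial n a b = 0 := by
  have e : X * (1 - X) * derivative (derivative (jacobiPolynomial n a b)) +
      (C (1 + a) - C (a + b + 2) * X) * derivative (jacobiPolynomial n a b) +
      C (n * (n + a + b + 1)) * jacobiPolynomial n a b =
      X * derivative (derivative (jacobiPolynomial n a b)) -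
      X * (X * derivative (derivative (jacobiPolynomial n a b))) +
      C (1 + a) * derivative (jacobiPolynomial n a b) -
      C (a + b + 2) * (X * derivative (jacobiPolynomial n a b)) +
      C (n * (n + a + b + 1)) * jacobiPolynomial n a b := by ring
  rw [e]
  ext k
  rcases k with _ | _ | k
  · have := coeff_jacobiPolynomial_succ (b := b) ha n 0
    simp only [coeff_add, coeff_sub, coeff_C_mul, coeff_X_mul_zero, coeff_derivative, coeff_zero]
    push_cast at this ⊢
    linear_combination this
  · have := coeff_jacobiPolynomial_succ (b := b) ha n 1
    simp only [coeff_add, coeff_sub, coeff_C_mul, coeff_X_mul, coeff_X_mul_zero, coeff_derivative,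
      coeff_zero]
    push_cast at this ⊢
    linear_combination this
  · have := coeff_jacobiPolynomial_succ (b := b) ha n (k + 2)
    simp only [coeff_add, coeff_sub, coeff_C_mul, coeff_X_mul, coeff_derivative, coeff_zero]
    push_cast at this ⊢
    linear_combination this

/-- One step of the Rodrigues formula: the right side has the shape that integration by parts
annihilates. It is the differential equation at degree n + 1 with the derivatives replaced by the
polynomial with raised parameters; a + b > -2 keeps the eigenvalue nonzero, so it can be cancelled.
-/
theorem jacobiPolynomial_succ (ha : -1 < a) (hab : -2 < a + b) (n : ℕ) :
    C (1 + a) * jacobiPolynomial (n + 1) a b =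
      (C (1 + a) * (1 - X) - C (1 + b) * X) * jacobiPolynomial n (a + 1) (b + 1) +
        X * (1 - X) * derivative (jacobiPolynomial n (a + 1) (b + 1)) := by
  have h1 := jacobiPolynomial_ode (b := b) ha (n + 1)
  have h2 := derivative_jacobiPolynomial_succ (b := b) ha n
  have h3 := congrArg derivative h2
  simp only [derivative_C_mul] at h3
  have hn : C (-(((n : ℝ) + 1) * (n + a + b + 2))) ≠ 0 := by
    rw [Ne, C_eq_zero]
    have : 0 < ((n : ℝ) + 1) * (n + a + b + 2) := by
      have := n.cast_nonneg (α := ℝ)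
      apply mul_pos <;> linarith
    linarith
  apply mul_left_cancel₀ hn
  push_cast at h1
  have e1 : C (((n : ℝ) + 1) * ((n : ℝ) + 1 + a + b + 1)) = -C (-(((n : ℝ) + 1) * (n + a + b + 2))) := by
    rw [← C_neg]; congr 1; ring
  have e2 : C (a + b + 2) = C (1 + a) + C (1 + b) := by rw [← C_add]; congr 1; ring
  rw [e1, e2] at h1
  linear_combination (-C (1 + a)) * h1 + X * (1 - X) * h3 +
    ((C (1 + a) * (1 - X) - C (1 + b) * X)) * h2

theorem jacobiPolynomial_zero : jacobiPolynomial 0 a b = 1 := by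
  simp [jacobiPolynomial, ordinaryHypergeometricCoefficient]

/-- Induction by `jacobiPolynomial_succ`: in the weight with exponent c in place of 1 + a,
integration by parts leaves only (1 + a - c)(1 - X) times the raised polynomial. Each step thus
yields one factor of the shifted factorial and raises b by one. -/
theorem betaMoment_jacobiPolynomial (n : ℕ) {a b c : ℝ} (ha : -1 < a) (hb : -1 < b) (hc : 0 < c) :
    betaMoment c (b + 1) (jacobiPolynomial n a b) =
      (ascPochhammer ℝ n).eval (1 + a - c) / (ascPochhammer ℝ n).eval (1 + a) *
        (Real.Gamma c * Real.Gamma (b + n + 1) / Real.Gamma (c + (b + n + 1))) := by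
  induction n generalizing a b with
  | zero => simp [jacobiPolynomial_zero, betaMoment_one hc (show 0 < b + 1 by linarith)]
  | succ n ih =>
    have hb1 : 0 < b + 1 := by linarith
    set G := jacobiPolynomial n (a + 1) (b + 1) with hG
    have h1 := betaMoment_derivative hc hb1 G
    have h2 := congrArg (betaMoment c (b + 1))
      (jacobiPolynomial_succ (b := b) ha (by linarith) n)
    have e : (C (1 + a) * (1 - X) - C (1 + b) * X) * G + X * (1 - X) * derivative G =
        ((C c * (1 - X) - C (b + 1) * X) * G + X * (1 - X) * derivative G) +
          C (1 + a - c) * ((1 - X) * G) := by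
      simp only [C_add, C_sub, C_1]; ring
    rw [← hG, e, betaMoment_add hc hb1, h1, betaMoment_C_mul, betaMoment_C_mul,
      betaMoment_one_sub_X_mul, ih (by linarith) (by linarith)] at h2
    have ha1 : 1 + a ≠ 0 := by linarith
    rw [ascPochhammer_succ_eval_left, ascPochhammer_succ_eval_left]
    rw [show 1 + (a + 1) - c = 1 + a - c + 1 by ring, show 1 + (a + 1) = 1 + a + 1 by ring,
      show b + 1 + n + 1 = b + (n + 1 : ℕ) + 1 by push_cast; ring] at h2
    apply mul_left_cancel₀ ha1
    rw [h2]
    field_simp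
    ring

/-- `jacobiPolynomial n a b` is orthogonal to the polynomials of lower degree. -/
theorem betaMoment_jacobiPolynomial_mul_of_natDegree_lt {n : ℕ} (ha : -1 < a) (hb : -1 < b)
    {Q : ℝ[X]} (hQ : Q.natDegree < n) :
    betaMoment (a + 1) (b + 1) (jacobiPolynomial n a b * Q) = 0 := by
  have ha1 : 0 < a + 1 := by linarith
  have hb1 : 0 < b + 1 := by linarith
  -- X^j moves c from a + 1 to a + 1 + j, where the factor (1 + a - c)_n = (-j)_n vanishes because j
  -- < n.
  have key : ∀ j < n, betaMoment (a + 1) (b + 1) (jacobiPolynomial n a b * X ^ j) = 0 := by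
    intro j hj
    have : ∀ (j : ℕ) (p : ℝ), betaMoment p (b + 1) (jacobiPolynomial n a b * X ^ j) =
        betaMoment (p + j) (b + 1) (jacobiPolynomial n a b) := by
      intro j
      induction j with
      | zero => simp
      | succ j ih =>
        intro p
        rw [show jacobiPolynomial n a b * X ^ (j + 1) = X * (jacobiPolynomial n a b * X ^ j) by ring,
          betaMoment_X_mul, ih]
        push_cast; congr 1; ring
    rw [this, betaMoment_jacobiPolynomial n ha hb (by positivity),
      (ascPochhammer_eval_eq_zero_iff n _).2 ⟨j, hj, by ring⟩]
    simp
  rw [Q.as_sum_range_C_mul_X_pow, Finset.mul_sum]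
  have hsum : ∀ s : Finset ℕ, (∀ j ∈ s, j < n) → betaMoment (a + 1) (b + 1)
      (∑ j ∈ s, jacobiPolynomial n a b * (C (Q.coeff j) * X ^ j)) = 0 := by
    intro s
    induction s using Finset.cons_induction with
    | empty => simp [betaMoment]
    | cons j s hj ih =>
      intro h
      rw [Finset.sum_cons, betaMoment_add ha1 hb1, ih fun i hi => h i (by simp [hi]),
        show jacobiPolynomial n a b * (C (Q.coeff j) * X ^ j) =
          C (Q.coeff j) * (jacobiPolynomial n a b * X ^ j) by ring, betaMoment_C_mul,
        key j (h j (by simp))]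
      simp
  exact hsum _ fun j hj => by have := Finset.mem_range.1 hj; omega

theorem natDegree_jacobiPolynomial_le (n : ℕ) (a b : ℝ) :
    (jacobiPolynomial n a b).natDegree ≤ n :=
  natDegree_sum_le_of_forall_le _ _ fun k hk =>
    (natDegree_C_mul_X_pow_le _ _).trans (by have := Finset.mem_range.1 hk; omega)

theorem natDegree_derivative_jacobiPolynomial_lt {n : ℕ} (hn : n ≠ 0) (a b : ℝ) :
    (derivative (jacobiPolynomial n a b)).natDegree < n :=
  (natDegree_derivative_le _).trans_lt
    (by have := natDegree_jacobiPolynomial_le n a b; omega)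

theorem betaMoment_jacobiPolynomial_sq (n : ℕ) (ha : 0 < a) (hb : 0 < b) :
    betaMoment a b (jacobiPolynomial n a b ^ 2) =
      (a + b) / b * (n.factorial / (ascPochhammer ℝ n).eval (1 + a) *
        (Real.Gamma a * Real.Gamma (b + n + 1) / Real.Gamma (a + (b + n + 1)))) := by
  set P := jacobiPolynomial n a b with hP
  have ha' : -1 < a := by linarith
  have hb' : -1 < b := by linarith
  have hb1 : 0 < b + 1 := by linarith
  have hPP' : betaMoment (a + 1) (b + 1) (P * derivative P) = 0 := by
    rcases eq_or_ne n 0 with rfl | hn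
    · simp [hP, jacobiPolynomial_zero, betaMoment]
    · exact betaMoment_jacobiPolynomial_mul_of_natDegree_lt ha' hb'
        (natDegree_derivative_jacobiPolynomial_lt hn a b)
  -- Integrate the derivative of t^a (1-t)^b P²; the term with P·P' drops out by orthogonality to
  -- lower degrees.
  have h1 : a * betaMoment a (b + 1) (P ^ 2) = b * betaMoment (a + 1) b (P ^ 2) := by
    have h := betaMoment_derivative ha hb (P ^ 2)
    have e : (C a * (1 - X) - C b * X) * P ^ 2 + X * (1 - X) * derivative (P ^ 2) =
        C a * ((1 - X) * P ^ 2) + (C (-b) * (X * P ^ 2) +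
          C 2 * (X * ((1 - X) * (P * derivative P)))) := by
      rw [derivative_sq, C_neg]; ring
    rw [e, betaMoment_add ha hb, betaMoment_add ha hb, betaMoment_C_mul, betaMoment_C_mul,
      betaMoment_C_mul, betaMoment_X_mul, betaMoment_X_mul, betaMoment_one_sub_X_mul,
      betaMoment_one_sub_X_mul, hPP'] at h
    linarith
  have h2 : betaMoment a b (P ^ 2) =
      betaMoment (a + 1) b (P ^ 2) + betaMoment a (b + 1) (P ^ 2) := by
    rw [← betaMoment_X_mul, ← betaMoment_one_sub_X_mul, ← betaMoment_add ha hb]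
    congr 1; ring
  -- Since P(0) = 1, P² = P + X·P·R with deg R < n, and the extra X restores the orthogonality
  -- weight.
  have h3 : betaMoment a (b + 1) (P ^ 2) = betaMoment a (b + 1) P := by
    have h0 : P.coeff 0 = 1 := by
      simp [hP, coeff_jacobiPolynomial, ordinaryHypergeometricCoefficient]
    have e : P ^ 2 = P + X * (P * divX P) := by
      have := P.X_mul_divX_add
      rw [h0, C_1] at this
      linear_combination -P * this
    rw [e, betaMoment_add ha hb1, betaMoment_X_mul]
    rcases eq_or_ne n 0 with rfl | hn
    · simp [hP, jacobiPolynomial_zero, betaMoment]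
    · rw [betaMoment_jacobiPolynomial_mul_of_natDegree_lt ha' hb', add_zero]
      rw [natDegree_divX_eq_natDegree_tsub_one]
      have : P.natDegree ≤ n := natDegree_jacobiPolynomial_le n a b
      omega
  have h4 := betaMoment_jacobiPolynomial n ha' hb' ha
  rw [show 1 + a - a = 1 by ring, ascPochhammer_eval_one, ← hP, ← h3] at h4
  rw [h2, ← h4]
  field_simp
  linear_combination -h1

/-- Orthogonality of Jacobi polynomials with varying parameters: after multiplication by
`t^(a/2) (1-t)^(b/2)`, they are eigenfunctions of one and the same Sturm-Liouville operator. -/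
theorem betaMoment_jacobiPolynomial_mul_eq_zero {m n : ℕ} {a b a' b' : ℝ} (ha : 0 < a) (hb : 0 < b)
    (ha' : 0 < a') (hb' : 0 < b') (hdeg : a + b + 2 * m = a' + b' + 2 * n)
    (hsq : a ^ 2 - b ^ 2 = a' ^ 2 - b' ^ 2) (hne : a ≠ a') :
    betaMoment ((a + a') / 2) ((b + b') / 2)
      (jacobiPolynomial m a b * jacobiPolynomial n a' b') = 0 := by
  have hp : 0 < (a + a') / 2 := by positivity
  have hq : 0 < (b + b') / 2 := by positivity
  set F := jacobiPolynomial m a b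
  set G := jacobiPolynomial n a' b'
  have hF := jacobiPolynomial_ode (b := b) (show -1 < a by linarith) m
  have hG := jacobiPolynomial_ode (b := b') (show -1 < a' by linarith) n
  -- The polynomial is the Wronskian t(1-t)(f'g - fg') of f = t^(a/2) (1-t)^(b/2) F and g = t^(a'/2)
  -- (1-t)^(b'/2) G, stripped of its powers of t and 1 - t.
  have h := betaMoment_derivative hp hq ((C ((a - a') / 2) * (1 - X) - C ((b - b') / 2) * X) *
    (F * G) + X * (1 - X) * (derivative F * G - F * derivative G))
  -- Only the difference a²/4 - a'²/4 of the eigenvalues survives, because `hdeg` and `hsq` make the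
  -- rest of the two equations agree.
  have e : (C ((a + a') / 2) * (1 - X) - C ((b + b') / 2) * X) *
      ((C ((a - a') / 2) * (1 - X) - C ((b - b') / 2) * X) * (F * G) +
        X * (1 - X) * (derivative F * G - F * derivative G)) +
      X * (1 - X) * derivative ((C ((a - a') / 2) * (1 - X) - C ((b - b') / 2) * X) * (F * G) +
        X * (1 - X) * (derivative F * G - F * derivative G)) =
      C ((a ^ 2 - a' ^ 2) / 4) * (F * G) := by
    refine Polynomial.funext fun t => ?_
    have hFt := congrArg (eval t) hF
    have hGt := congrArg (eval t) hG
    simp only [derivative_add, derivative_sub, derivative_mul, derivative_C, derivative_X,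
      derivative_one, eval_add, eval_sub, eval_mul, eval_C, eval_X, eval_one, eval_zero] at *
    linear_combination (t * (1 - t) * eval t G) * hFt - (t * (1 - t) * eval t F) * hGt -
      (eval t F * eval t G * t / 4) * hsq - (eval t F * eval t G * t * (1 - t) *
        (a + b + 2 * m + 1 + (a' + b' + 2 * n + 1)) / 4) * hdeg
  rw [e, betaMoment_C_mul] at h
  refine (mul_eq_zero.1 h).resolve_left ?_
  intro h0
  have : (a - a') * (a + a') = 0 := by linarith
  rcases mul_eq_zero.1 this with h | h
  · exact hne (by linarith)
  · linarith

end JacobiPolynomial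

/-! ### Square roots and the solutions λ_n -/

theorem Complex.sqrt_sq' (z : ℂ) : Complex.sqrt z ^ 2 = z := by
  simp [Complex.sqrt]

theorem Complex.re_sqrt_nonneg (z : ℂ) : 0 ≤ (Complex.sqrt z).re := by
  rw [Complex.sqrt, Complex.cpow_inv_two_re]
  positivity

open ComplexOrder in
theorem Complex.sqrt_ofReal_sq {r : ℝ} (hr : 0 ≤ r) : Complex.sqrt ((r : ℂ) ^ 2) = r := by
  have h : (0 : ℂ) ≤ (r : ℂ) ^ 2 := by
    rw [← Complex.ofReal_pow]
    exact Complex.zero_le_real.2 (sq_nonneg r)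
  rw [Complex.sqrt_of_nonneg h, ← Complex.ofReal_pow, Complex.ofReal_re, Real.sqrt_sq hr]

section Eigenvalues

variable {α β κ : ℝ} {n : ℕ} {z : ℂ}

theorem deltaFn_sq (α : ℝ) (z : ℂ) : deltaFn α z ^ 2 = z + ((α : ℂ) + 1) ^ 2 :=
  Complex.sqrt_sq' _

theorem etaFn_sq (β : ℝ) (z : ℂ) : etaFn β z ^ 2 = z + ((β : ℂ) + 1) ^ 2 :=
  Complex.sqrt_sq' _

/-- The sum δ + η is real by assumption, and (η - δ)(η + δ) is real because λ cancels. So η - δ is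
real once the sum is nonzero, and principal roots have nonnegative real part. -/
theorem IsLambda.exists_real (hα : -1 < α) (hαβ : α ≤ β) (h : IsLambda α β κ n z)
    (hz : z ≠ -((α : ℂ) + 1) ^ 2) :
    ∃ d e : ℝ, 0 < d ∧ 0 < e ∧ deltaFn α z = d ∧ etaFn β z = e ∧ d + e = κ - 2 * n - 1 ∧
      e ^ 2 - d ^ 2 = (β - α) * (α + β + 2) ∧ z = ((d ^ 2 - (α + 1) ^ 2 : ℝ) : ℂ) := by
  have hd := deltaFn_sq α z
  have he := etaFn_sq β z
  have hdr : 0 ≤ (deltaFn α z).re := Complex.re_sqrt_nonneg _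
  have her : 0 ≤ (etaFn β z).re := Complex.re_sqrt_nonneg _
  have hd0 : deltaFn α z ≠ 0 := by
    intro h0
    rw [h0] at hd
    exact hz (by linear_combination -hd)
  unfold IsLambda at h
  have hs : deltaFn α z + etaFn β z = ((κ - 2 * n - 1 : ℝ) : ℂ) := by
    rw [h]; push_cast; ring
  have hdiff : (etaFn β z - deltaFn α z) * ((κ - 2 * n - 1 : ℝ) : ℂ) =
      (((β - α) * (α + β + 2) : ℝ) : ℂ) := by
    rw [← hs]; push_cast; linear_combination he - hd
  have hre := congrArg Complex.re hs
  have him := congrArg Complex.im hs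
  rw [Complex.add_re, Complex.ofReal_re] at hre
  rw [Complex.add_im, Complex.ofReal_im] at him
  -- A zero sum would force α = β, hence δ = η = 0, which is the excluded endpoint.
  have hs0 : κ - 2 * n - 1 ≠ 0 := by
    intro h0
    rw [h0] at hdiff hs
    have hA : (β - α) * (α + β + 2) = 0 := by
      have := hdiff.symm
      rw [Complex.ofReal_zero, mul_zero] at this
      exact_mod_cast this
    have hβ : β = α := by
      rcases mul_eq_zero.1 hA with h | h <;> linarith
    subst hβ
    have : etaFn β z = deltaFn β z := rfl
    rw [this] at hs
    apply hd0
    rw [Complex.ofReal_zero] at hs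
    linear_combination hs / 2
  have hdi := congrArg Complex.im hdiff
  rw [Complex.im_mul_ofReal, Complex.ofReal_im, Complex.sub_im] at hdi
  have hdi0 := (mul_eq_zero.1 hdi).resolve_right hs0
  have hdr' : deltaFn α z = ((deltaFn α z).re : ℂ) :=
    Complex.ext (by simp) (by rw [Complex.ofReal_im]; linarith)
  have her' : etaFn β z = ((etaFn β z).re : ℂ) :=
    Complex.ext (by simp) (by rw [Complex.ofReal_im]; linarith)
  set d := (deltaFn α z).re
  set e := (etaFn β z).re
  rw [hdr'] at hd hd0
  rw [her'] at he
  have hd1 : 0 < d := lt_of_le_of_ne hdr (by rintro h0; exact hd0 (by rw [← h0]; simp))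
  have hed : e ^ 2 - d ^ 2 = (β - α) * (α + β + 2) := by
    have : (e : ℂ) ^ 2 - (d : ℂ) ^ 2 = (β - α) * (α + β + 2) := by linear_combination he - hd
    exact_mod_cast this
  have hA : 0 ≤ (β - α) * (α + β + 2) := mul_nonneg (by linarith) (by linarith)
  refine ⟨d, e, hd1, ?_, hdr', her', hre, hed, ?_⟩
  · refine lt_of_le_of_ne her ?_
    rintro h0
    rw [← h0] at hed
    nlinarith
  · push_cast
    linear_combination -hd

/-- With s = κ - 2n - 1 and A = (β-α)(α+β+2), the sum s and the difference A/s give δ = (s - A/s)/2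
and η = (s + A/s)/2. The condition δ > 0 reads A < s². -/
theorem isLambda_iff (hα : -1 < α) (hαβ : α ≤ β) :
    (IsLambda α β κ n z ∧ z ≠ -((α : ℂ) + 1) ^ 2) ↔
      (√((β - α) * (α + β + 2)) < κ - 2 * n - 1 ∧
        z = (((-n + (κ - 1) / 2 + (α - β) * (α + β + 2) / (-4 * n - 2 + 2 * κ)) ^ 2
          - (α + 1) ^ 2 : ℝ) : ℂ)) := by
  have hA : 0 ≤ (β - α) * (α + β + 2) := mul_nonneg (by linarith) (by linarith)
  constructor
  · rintro ⟨h, hz⟩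
    obtain ⟨d, e, hd, he, -, -, hs, hed, rfl⟩ := h.exists_real hα hαβ hz
    have hs0 : 0 < κ - 2 * n - 1 := by linarith
    refine ⟨?_, ?_⟩
    · rw [Real.sqrt_lt' hs0, ← hed, ← hs]
      nlinarith
    · congr 3
      have h0 : d + e ≠ 0 := by linarith
      rw [show (α - β) * (α + β + 2) = d ^ 2 - e ^ 2 by linarith,
        show -4 * (n : ℝ) - 2 + 2 * κ = 2 * (d + e) by linarith,
        show -(n : ℝ) + (κ - 1) / 2 = (d + e) / 2 by linarith]
      field_simp
      ring
  · rintro ⟨hs, rfl⟩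
    have hs0 : 0 < κ - 2 * n - 1 := (Real.sqrt_nonneg _).trans_lt hs
    rw [Real.sqrt_lt' hs0] at hs
    set s := κ - 2 * n - 1 with hsdef
    set A := (β - α) * (α + β + 2) with hAdef
    have hd : -n + (κ - 1) / 2 + (α - β) * (α + β + 2) / (-4 * n - 2 + 2 * κ) = (s - A / s) / 2 := by
      rw [show -4 * (n : ℝ) - 2 + 2 * κ = 2 * s by rw [hsdef]; ring,
        show (α - β) * (α + β + 2) = -A by rw [hAdef]; ring]
      field_simp
      rw [hsdef]; ring
    rw [hd]
    have hd1 : 0 < (s - A / s) / 2 := by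
      have : A / s < s := by rw [div_lt_iff₀ hs0]; nlinarith
      linarith
    have he1 : 0 ≤ (s + A / s) / 2 := by positivity
    have hdel : deltaFn α ((((s - A / s) / 2) ^ 2 - (α + 1) ^ 2 : ℝ) : ℂ) =
        (((s - A / s) / 2 : ℝ) : ℂ) := by
      rw [← Complex.sqrt_ofReal_sq hd1.le, deltaFn]
      congr 1; push_cast; ring
    have heta : etaFn β ((((s - A / s) / 2) ^ 2 - (α + 1) ^ 2 : ℝ) : ℂ) =
        (((s + A / s) / 2 : ℝ) : ℂ) := by
      rw [← Complex.sqrt_ofReal_sq he1, etaFn, ← Complex.ofReal_one, ← Complex.ofReal_add,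
        ← Complex.ofReal_pow, ← Complex.ofReal_pow, ← Complex.ofReal_add]
      congr 2
      have : s * (A / s) = A := by field_simp
      linear_combination hAdef - this
    refine ⟨?_, fun h0 => ?_⟩
    · rw [IsLambda, hdel, heta, ← Complex.ofReal_add,
        show (s - A / s) / 2 + (s + A / s) / 2 = κ - 2 * n - 1 by rw [← hsdef]; ring]
      push_cast; ring
    · have h1 := deltaFn_sq α ((((s - A / s) / 2) ^ 2 - (α + 1) ^ 2 : ℝ) : ℂ)
      rw [hdel, h0, neg_add_cancel] at h1
      exact hd1.ne' (by exact_mod_cast pow_eq_zero_iff two_ne_zero |>.1 h1)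

end Eigenvalues

/-! ### Poles of Gamma and the residue formula for N -/

theorem Complex.tendsto_add_nat_mul_Gamma (n : ℕ) :
    Tendsto (fun w : ℂ => (w + n) * Complex.Gamma w) (𝓝[≠] (-(n : ℂ)))
      (𝓝 ((-1) ^ n / (n.factorial : ℂ))) := by
  induction n with
  | zero => simpa using Complex.tendsto_self_mul_Gamma_nhds_zero
  | succ n ih =>
    have hshift : Tendsto (fun w : ℂ => w + 1) (𝓝[≠] (-((n + 1 : ℕ) : ℂ))) (𝓝[≠] (-(n : ℂ))) := by
      refine tendsto_nhdsWithin_iff.2 ⟨?_, ?_⟩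
      · have : Tendsto (fun w : ℂ => w + 1) (𝓝 (-((n + 1 : ℕ) : ℂ))) (𝓝 (-((n + 1 : ℕ) : ℂ) + 1)) :=
          (continuous_id.add continuous_const).tendsto _
        rw [show -((n + 1 : ℕ) : ℂ) + 1 = -(n : ℂ) by push_cast; ring] at this
        exact this.mono_left nhdsWithin_le_nhds
      · filter_upwards [self_mem_nhdsWithin] with w hw h
        apply hw
        rw [mem_singleton_iff] at h ⊢
        push_cast
        linear_combination h
    have h0 : (-((n + 1 : ℕ) : ℂ)) ≠ 0 := neg_ne_zero.2 (Nat.cast_ne_zero.2 n.succ_ne_zero)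
    have hinv : Tendsto (fun w : ℂ => w⁻¹) (𝓝[≠] (-((n + 1 : ℕ) : ℂ)))
        (𝓝 (-((n + 1 : ℕ) : ℂ))⁻¹) := (tendsto_inv₀ h0).mono_left nhdsWithin_le_nhds
    have h := (ih.comp hshift).mul hinv
    have e : (-1 : ℂ) ^ n / (n.factorial : ℂ) * (-((n + 1 : ℕ) : ℂ))⁻¹ =
        (-1) ^ (n + 1) / ((n + 1).factorial : ℂ) := by
      rw [Nat.factorial_succ, inv_neg, pow_succ, Nat.cast_mul, div_eq_mul_inv, div_eq_mul_inv,
        mul_inv]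
      ring
    rw [e] at h
    refine h.congr' ?_
    filter_upwards [mem_nhdsWithin_of_mem_nhds (isOpen_ne.mem_nhds h0)] with w hw
    have hw : w ≠ 0 := hw
    simp only [Function.comp_apply, Complex.Gamma_add_one w hw]
    field_simp
    push_cast; ring

theorem Complex.neg_one_pow_mul_Gamma_neg {x : ℂ} (hx : ∀ k : ℕ, x ≠ -(k : ℂ) - 1) (n : ℕ) :
    (-1) ^ n * Complex.Gamma (-x) =
      (ascPochhammer ℂ n).eval (1 + x) * Complex.Gamma (-x - n) := by
  induction n with
  | zero => simp
  | succ n ih =>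
    have h0 : -x - ((n + 1 : ℕ) : ℂ) ≠ 0 := by
      intro h
      apply hx n
      push_cast at h
      linear_combination -h
    have := Complex.Gamma_add_one _ h0
    rw [show -x - ((n + 1 : ℕ) : ℂ) + 1 = -x - n by push_cast; ring] at this
    rw [pow_succ, mul_right_comm, ih, this, ascPochhammer_succ_eval]
    push_cast; ring

section Residue

variable {α β κ : ℝ} {n : ℕ} {z : ℂ}

theorem Complex.mem_slitPlane_of_sqrt_eq {w : ℂ} {r : ℝ} (hr : 0 < r)
    (h : Complex.sqrt w = r) : w ∈ Complex.slitPlane := by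
  rw [← Complex.sqrt_sq' w, h, ← Complex.ofReal_pow]
  exact Complex.ofReal_mem_slitPlane.2 (by positivity)

theorem Complex.hasDerivAt_sqrt_add_const {c z : ℂ} {r : ℝ} (hr : 0 < r)
    (h : Complex.sqrt (z + c) = r) :
    HasDerivAt (fun w => Complex.sqrt (w + c)) (1 / (2 * r : ℂ)) z := by
  have hd := (Complex.hasDerivAt_sqrt (Complex.mem_slitPlane_of_sqrt_eq hr h)).comp_add_const z c
  refine hd.congr_deriv ?_
  rw [show (-1 / 2 : ℂ) = -2⁻¹ by norm_num, Complex.cpow_neg]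
  change (Complex.sqrt (z + c))⁻¹ / 2 = _
  rw [h]
  field_simp

theorem Complex.analyticAt_sqrt_add_const {c z : ℂ} {r : ℝ} (hr : 0 < r)
    (h : Complex.sqrt (z + c) = r) : AnalyticAt ℂ (fun w => Complex.sqrt (w + c)) z := by
  have h1 : AnalyticAt ℂ Complex.sqrt (z + c) :=
    Complex.differentiableOn_sqrt.analyticAt
      (Complex.isOpen_slitPlane.mem_nhds (Complex.mem_slitPlane_of_sqrt_eq hr h))
  exact h1.fun_comp (f := fun w => w + c) (analyticAt_id.add analyticAt_const)

theorem meromorphicAt_cFn {x y : ℂ → ℂ} (κ : ℝ) (hx : AnalyticAt ℂ x z) (hy : AnalyticAt ℂ y z) :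
    MeromorphicAt (fun w => cFn κ (x w) (y w)) z := by
  have hG : ∀ {g : ℂ → ℂ}, AnalyticAt ℂ g z → MeromorphicAt (fun w => Complex.Gamma (g w)) z :=
    fun {g} hg => (Meromorphic.Gamma (g z)).comp_analyticAt hg
  unfold cFn
  exact ((hG (by fun_prop)).mul (hG (by fun_prop))).div
    ((hG (by fun_prop)).mul (hG (by fun_prop)))

/-- Γ(1+y) cancels, and the one factor that is singular at λ_n is put in front. -/
theorem cFn_div_cFn_neg {x y : ℂ} (κ : ℝ) (hy : Complex.Gamma (1 + y) ≠ 0) :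
    cFn κ x y / (x * cFn κ (-x) y) = Complex.Gamma ((1 + y + x - κ) / 2) *
      (Complex.Gamma (-x) * Complex.Gamma ((1 + y + x + κ) / 2) * (x * Complex.Gamma x)⁻¹ *
        (Complex.Gamma ((1 + y - x + κ) / 2))⁻¹ * (Complex.Gamma ((1 + y - x - κ) / 2))⁻¹) := by
  unfold cFn
  simp only [neg_neg, sub_neg_eq_add, div_eq_mul_inv, mul_inv, inv_inv]
  have h := mul_inv_cancel₀ hy
  linear_combination Complex.Gamma ((1 + y + x - κ) * 2⁻¹) *
      (Complex.Gamma (-x) * Complex.Gamma ((1 + y + x + κ) * 2⁻¹) * (x⁻¹ * (Complex.Gamma x)⁻¹) *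
        (Complex.Gamma ((1 + y - x + κ) * 2⁻¹))⁻¹ *
        (Complex.Gamma ((1 + y - x - κ) * 2⁻¹))⁻¹) * h

theorem normConst_eq_normConstGamma (hα : -1 < α) (hαβ : α ≤ β) (h : IsLambda α β κ n z)
    (hz : z ≠ -((α : ℂ) + 1) ^ 2) (hη : ∀ k : ℕ, etaFn β z ≠ k) :
    normConst α β κ n z = normConstGamma α β κ n z := by
  obtain ⟨d, e, hd, he, hde, hee, hs, -, -⟩ := h.exists_real hα hαβ hz
  unfold normConst normConstGamma
  rw [hde, hee]
  have harg : (1 + (d : ℂ) - e - κ) / 2 = -e - n := by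
    have : (d : ℂ) + e = κ - 2 * n - 1 := by exact_mod_cast hs
    linear_combination this / 2
  have hne : ∀ k : ℕ, (e : ℂ) ≠ -(k : ℂ) - 1 := by
    intro k hk
    have : e = -(k : ℝ) - 1 := by exact_mod_cast hk
    have := k.cast_nonneg (α := ℝ)
    linarith
  -- Off the poles Γ has no zeros; a pole here would make η a natural number.
  have hG : Complex.Gamma (-(e : ℂ) - n) ≠ 0 := by
    refine Complex.Gamma_ne_zero fun m hm => ?_
    have h1 : e = (m : ℝ) - n := by
      have : (e : ℂ) = m - n := by linear_combination -hm
      exact_mod_cast this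
    have hmn : n ≤ m := by
      have : (n : ℝ) ≤ m := by linarith
      exact_mod_cast this
    apply hη (m - n)
    rw [h1] at hee
    rw [hee]
    push_cast [hmn]
    rfl
  rw [harg, ← mul_assoc ((-1 : ℂ) ^ n), Complex.neg_one_pow_mul_Gamma_neg hne n]
  congr 1
  rw [mul_right_comm, ← mul_assoc (n.factorial : ℂ) (_ * _), mul_div_mul_right _ _ hG]

/-- With g = (1+δ+η-κ)/2, the limit is that of (w-z)/(g(w)+n), times that of (g(w)+n)Γ(g(w)), times
the value at z of the remaining factors, which are continuous there. -/
theorem hasSimpleResidue_cQuotient (hα : -1 < α) (hαβ : α ≤ β) (h : IsLambda α β κ n z)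
    (hz : z ≠ -((α : ℂ) + 1) ^ 2) (hη : ∀ k : ℕ, etaFn β z ≠ k) :
    HasSimpleResidue (cQuotient α β κ) z (normConstGamma α β κ n z) := by
  obtain ⟨d, e, hd, he, hde, hee, hs, -, -⟩ := h.exists_real hα hαβ hz
  have hsC : (d : ℂ) + e = κ - 2 * n - 1 := by exact_mod_cast hs
  have hδan : AnalyticAt ℂ (deltaFn α) z := Complex.analyticAt_sqrt_add_const hd hde
  have hηan : AnalyticAt ℂ (etaFn β) z := Complex.analyticAt_sqrt_add_const he hee
  refine ⟨(meromorphicAt_cFn κ hηan hδan).div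
    (hηan.meromorphicAt.mul (meromorphicAt_cFn κ hηan.neg hδan)), ?_⟩
  have hdC : (d : ℂ) ≠ 0 := by exact_mod_cast hd.ne'
  have heC : (e : ℂ) ≠ 0 := by exact_mod_cast he.ne'
  have hdeC : (d : ℂ) + e ≠ 0 := by
    have : d + e ≠ 0 := by positivity
    exact_mod_cast this
  have hδc := hδan.continuousAt
  have hηc := hηan.continuousAt
  have hg : HasDerivAt (fun w => (1 + deltaFn α w + etaFn β w - κ) / 2)
      ((1 / (2 * d : ℂ) + 1 / (2 * e : ℂ)) / 2) z :=
    ((((Complex.hasDerivAt_sqrt_add_const hd hde).const_add 1).add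
      (Complex.hasDerivAt_sqrt_add_const he hee)).sub_const _).div_const 2
  -- The derivative is (d+e)/(4de); its inverse supplies 4δ/(κ-2n-1), the surplus e cancelling the
  -- 1/η of the quotient.
  have hg' : (1 / (2 * d : ℂ) + 1 / (2 * e : ℂ)) / 2 ≠ 0 := by
    rw [show (1 / (2 * d : ℂ) + 1 / (2 * e : ℂ)) / 2 = (d + e) / (4 * d * e) by field_simp; ring]
    exact div_ne_zero hdeC (by simp [hdC, heC])
  have hgz : (1 + deltaFn α z + etaFn β z - κ) / 2 = -(n : ℂ) := by
    rw [hde, hee]; linear_combination hsC / 2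
  have hgt : Tendsto (fun w => (1 + deltaFn α w + etaFn β w - κ) / 2) (𝓝[≠] z)
      (𝓝[≠] (-(n : ℂ))) := by
    refine tendsto_nhdsWithin_iff.2 ⟨?_, hg.eventually_ne hg'⟩
    rw [← hgz]
    exact hg.continuousAt.tendsto.mono_left nhdsWithin_le_nhds
  have hΓ := (Complex.tendsto_add_nat_mul_Gamma n).comp hgt
  have hsl := (hg.tendsto_slope.inv₀ hg')
  have hcont : ContinuousAt (fun w => Complex.Gamma (-etaFn β w) *
      Complex.Gamma ((1 + deltaFn α w + etaFn β w + κ) / 2) *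
      (etaFn β w * Complex.Gamma (etaFn β w))⁻¹ *
      (Complex.Gamma ((1 + deltaFn α w - etaFn β w + κ) / 2))⁻¹ *
      (Complex.Gamma ((1 + deltaFn α w - etaFn β w - κ) / 2))⁻¹) z := by
    have hpos : ∀ {x : ℝ}, 0 < x → ∀ m : ℕ, (x : ℂ) ≠ -m := by
      intro x hx m hm
      have : x = -(m : ℝ) := by exact_mod_cast hm
      have := m.cast_nonneg (α := ℝ)
      linarith
    -- 1/Γ is entire, so the last two factors need no restriction on their arguments.
    have hinv : Continuous fun s : ℂ => (Complex.Gamma s)⁻¹ :=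
      Complex.differentiable_one_div_Gamma.continuous
    refine (((ContinuousAt.mul ?_ ?_).mul ?_).mul ?_).mul ?_
    · refine ContinuousAt.comp' (f := fun w => -etaFn β w) ?_ (by fun_prop)
      exact Complex.continuousAt_Gamma _ fun m hm => hη m (neg_injective hm)
    · refine ContinuousAt.comp' (f := fun w => (1 + deltaFn α w + etaFn β w + κ) / 2) ?_
        (by fun_prop)
      refine Complex.continuousAt_Gamma _ ?_
      rw [hde, hee, show (1 + (d : ℂ) + e + κ) / 2 = ((d + e + n + 1 : ℝ) : ℂ) by
        push_cast; linear_combination -hsC / 2]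
      exact hpos (by positivity)
    · refine (hηc.mul (ContinuousAt.comp' ?_ hηc)).inv₀ ?_
      · rw [hee]
        exact Complex.continuousAt_Gamma _ (hpos he)
      · rw [Pi.mul_apply, hee]
        exact mul_ne_zero heC (Complex.Gamma_ne_zero (hpos he))
    · exact hinv.continuousAt.comp' (f := fun w => (1 + deltaFn α w - etaFn β w + κ) / 2)
        (by fun_prop)
    · exact hinv.continuousAt.comp' (f := fun w => (1 + deltaFn α w - etaFn β w - κ) / 2)
        (by fun_prop)
  have hlim := (hsl.mul hΓ).mul (hcont.tendsto.mono_left (nhdsWithin_le_nhds (s := {z}ᶜ)))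
  have hval : ((1 / (2 * d : ℂ) + 1 / (2 * e : ℂ)) / 2)⁻¹ * ((-1) ^ n / (n.factorial : ℂ)) *
      (Complex.Gamma (-etaFn β z) *
      Complex.Gamma ((1 + deltaFn α z + etaFn β z + κ) / 2) *
      (etaFn β z * Complex.Gamma (etaFn β z))⁻¹ *
      (Complex.Gamma ((1 + deltaFn α z - etaFn β z + κ) / 2))⁻¹ *
      (Complex.Gamma ((1 + deltaFn α z - etaFn β z - κ) / 2))⁻¹) = normConstGamma α β κ n z := by
    unfold normConstGamma
    rw [hde, hee, show (1 + (d : ℂ) + e + κ) / 2 = κ - n by linear_combination hsC / 2,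
      show -2 * (n : ℂ) - 1 + κ = d + e by linear_combination -hsC,
      show (1 / (2 * d : ℂ) + 1 / (2 * e : ℂ)) / 2 = (d + e) / (4 * d * e) by field_simp; ring]
    simp only [div_eq_mul_inv, mul_inv, inv_inv]
    have := mul_inv_cancel₀ heC
    generalize (Complex.Gamma ((1 + (d : ℂ) - e + κ) * 2⁻¹))⁻¹ = G1
    generalize (Complex.Gamma ((1 + (d : ℂ) - e - κ) * 2⁻¹))⁻¹ = G2
    linear_combination (4 * d * (d + e : ℂ)⁻¹ * (-1) ^ n * (n.factorial : ℂ)⁻¹ *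
      Complex.Gamma (-e) * Complex.Gamma (κ - n) * (Complex.Gamma e)⁻¹ * G1 * G2) * this
  rw [← hval]
  refine hlim.congr' ?_
  have hev : ∀ᶠ w in 𝓝 z, 0 < (1 + deltaFn α w).re := by
    have : ContinuousAt (fun w => (1 + deltaFn α w).re) z :=
      Complex.continuous_re.continuousAt.comp' (by fun_prop)
    refine this.eventually_const_lt ?_
    simp only [hde, Complex.add_re, Complex.one_re, Complex.ofReal_re]
    positivity
  filter_upwards [mem_nhdsWithin_of_mem_nhds hev, hg.eventually_ne hg' (c := -(n : ℂ)),
    self_mem_nhdsWithin] with w hw hgw hwz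
  rw [cQuotient, cFn_div_cFn_neg κ (Complex.Gamma_ne_zero_of_re_pos hw)]
  simp only [Function.comp_apply, slope_def_field, inv_div, hgz]
  have h1 : (1 + deltaFn α w + etaFn β w - κ) / 2 + n ≠ 0 := fun h0 =>
    hgw (by linear_combination h0)
  rw [sub_neg_eq_add, ← mul_assoc ((w - z) / _), div_mul_cancel₀ _ h1, mul_assoc]

end Residue

/-! ### Transfer to (-1,1) and the orthogonality relations -/

section Orthogonality

variable {α β κ : ℝ} {m n : ℕ} {z u : ℂ} {d e d' e' : ℝ}

theorem ofReal_ascPochhammer_eval (k : ℕ) (x : ℝ) :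
    (((ascPochhammer ℝ k).eval x : ℝ) : ℂ) = (ascPochhammer ℂ k).eval (x : ℂ) := by
  induction k with
  | zero => simp
  | succ k ih => simp [ascPochhammer_succ_eval, ih]

theorem hypPoly_eq_jacobiPolynomial (hη : etaFn β z = e) (hs : d + e = κ - 2 * n - 1) (x : ℝ) :
    hypPoly β κ n z x = (((jacobiPolynomial n e d).eval ((1 + x) / 2) : ℝ) : ℂ) := by
  have hb : (κ : ℂ) - n = ((n + e + d + 1 : ℝ) : ℂ) := by
    rw [show n + e + d + 1 = κ - n by linarith]; push_cast; rfl
  rw [hypPoly, ordinaryHypergeometric, ordinaryHypergeometric_sum_eq, hη, hb,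
    tsum_eq_sum (s := Finset.range (n + 1)), jacobiPolynomial, Polynomial.eval_finsetSum,
    Complex.ofReal_sum]
  · refine Finset.sum_congr rfl fun k _ => ?_
    simp only [Polynomial.eval_mul, Polynomial.eval_C, Polynomial.eval_pow, Polynomial.eval_X,
      ordinaryHypergeometricCoefficient, smul_eq_mul]
    push_cast [ofReal_ascPochhammer_eval]
    rfl
  · intro k hk
    have h0 : (ascPochhammer ℂ k).eval (-(n : ℂ)) = 0 :=
      (ascPochhammer_eval_eq_zero_iff k _).2
        ⟨n, by have := Finset.mem_range.not.1 hk; omega, by simp⟩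
    simp [h0]

theorem integral_comp_one_add_div_two (f : ℝ → ℝ) :
    ∫ x in (-1 : ℝ)..1, f ((1 + x) / 2) = 2 * ∫ t in (0 : ℝ)..1, f t := by
  have e : ∀ x : ℝ, (1 + x) / 2 = 1 / 2 * x + 1 / 2 := fun x => by ring
  simp only [e]
  rw [intervalIntegral.integral_comp_mul_add _ (by norm_num)]
  norm_num

theorem IntervalIntegrable.comp_one_add_div_two {f : ℝ → ℝ}
    (hf : IntervalIntegrable f volume 0 1) :
    IntervalIntegrable (fun x => f ((1 + x) / 2)) volume (-1) 1 := by
  have e : ∀ x : ℝ, (1 + x) / 2 = 1 / 2 * x + 1 / 2 := fun x => by ring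
  simp only [e]
  convert (hf.comp_add_right (1 / 2)).comp_mul_left (c := 1 / 2) using 1 <;> norm_num

/-- The weighted product of two Jacobi polynomials on `(0,1)` underlying both forms of the
orthogonality relations. -/
noncomputable def jacobiProduct (m n : ℕ) (d e d' e' t : ℝ) : ℝ :=
  t ^ ((e + e') / 2 - 1) * (1 - t) ^ ((d + d') / 2 - 1) *
    (jacobiPolynomial m e d * jacobiPolynomial n e' d').eval t

theorem intervalIntegrable_jacobiProduct (hd : 0 < d) (he : 0 < e) (hd' : 0 < d') (he' : 0 < e')
    (m n : ℕ) : IntervalIntegrable (jacobiProduct m n d e d' e') volume 0 1 :=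
  intervalIntegrable_betaWeight_mul_eval (by positivity) (by positivity) _

/-- Matches the norm with N through κ - n = e + (d+n+1) and (1+δ-η+κ)/2 = d + n + 1. -/
theorem betaMoment_jacobiPolynomial_sq_eq_div_normConst (hd : 0 < d) (he : 0 < e) (hδ : deltaFn α z = d)
    (hη : etaFn β z = e) (hs : d + e = κ - 2 * n - 1) :
    ((betaMoment e d (jacobiPolynomial n e d ^ 2) : ℝ) : ℂ) = 4 / normConst α β κ n z := by
  have hN : normConst α β κ n z = ((4 * d / (d + e) * ((ascPochhammer ℝ n).eval (1 + e) *
      Real.Gamma (e + (d + n + 1)) / (n.factorial * (Real.Gamma e * Real.Gamma (d + n + 1)))) : ℝ) :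
        ℂ) := by
    have hsC : (d : ℂ) + e = κ - 2 * n - 1 := by exact_mod_cast hs
    rw [normConst, hδ, hη]
    push_cast [ofReal_ascPochhammer_eval, ← Complex.Gamma_ofReal]
    rw [show (1 + (d : ℂ) - e + κ) / 2 = d + n + 1 by linear_combination -hsC / 2,
      show (κ : ℂ) - n = e + (d + n + 1) by linear_combination -hsC,
      show -2 * (n : ℂ) - 1 + κ = d + e by linear_combination -hsC]
  rw [hN, betaMoment_jacobiPolynomial_sq n he hd]
  have h1 := (ascPochhammer_pos n (1 + e) (by positivity)).ne'
  have h2 := (Real.Gamma_pos_of_pos he).ne'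
  have h3 := (Real.Gamma_pos_of_pos (show 0 < d + n + 1 by positivity)).ne'
  have h4 := (Real.Gamma_pos_of_pos (show 0 < e + (d + n + 1) by positivity)).ne'
  have h5 : (n.factorial : ℝ) ≠ 0 := by exact_mod_cast n.factorial_ne_zero
  have h6 : d + e ≠ 0 := by positivity
  rw [← Complex.ofReal_ofNat, ← Complex.ofReal_div]
  congr 1
  field_simp
  ring

theorem integral_jacobiProduct (hd : 0 < d) (he : 0 < e) (hd' : 0 < d') (he' : 0 < e')
    (hδ : deltaFn α u = d') (hη : etaFn β u = e')
    (hs : d + e = κ - 2 * m - 1) (hs' : d' + e' = κ - 2 * n - 1)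
    (hsq : e ^ 2 - d ^ 2 = (β - α) * (α + β + 2))
    (hsq' : e' ^ 2 - d' ^ 2 = (β - α) * (α + β + 2)) :
    ((∫ t in (0 : ℝ)..1, jacobiProduct m n d e d' e' t : ℝ) : ℂ) =
      if m = n then 4 / normConst α β κ n u else 0 := by
  change ((betaMoment ((e + e') / 2) ((d + d') / 2)
    (jacobiPolynomial m e d * jacobiPolynomial n e' d') : ℝ) : ℂ) = _
  split_ifs with h
  · subst h
    -- For m = n the sums agree, and the common value of e² - d² then fixes the differences too.
    have h1 : (e - d) * (d + e) = (e' - d') * (d + e) := by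
      rw [hs, ← hs']
      linarith [hsq, hsq', show (e - d) * (d' + e') = (e - d) * (d + e) by rw [hs, hs']]
    have h2 := mul_right_cancel₀ (by positivity) h1
    obtain rfl : e' = e := by linarith
    obtain rfl : d' = d := by linarith
    rw [← betaMoment_jacobiPolynomial_sq_eq_div_normConst hd he hδ hη hs, add_self_div_two, add_self_div_two, sq]
  · rw [betaMoment_jacobiPolynomial_mul_eq_zero he hd he' hd' (by linarith) (by linarith)]
    · simp
    · rintro rfl
      have hdd : d = d' := by
        have : d ^ 2 = d' ^ 2 := by linarith
        exact (sq_eq_sq₀ hd.le hd'.le).1 this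
      apply h
      have : (m : ℝ) = n := by linarith
      exact_mod_cast this

theorem orthIntegrand_eq (hδ : deltaFn α z = d) (hη : etaFn β z = e)
    (hδ' : deltaFn α u = d') (hη' : etaFn β u = e')
    (hs : d + e = κ - 2 * m - 1) (hs' : d' + e' = κ - 2 * n - 1) {x : ℝ} (hx : x ∈ Ioo (-1 : ℝ) 1) :
    orthIntegrand α β κ m n z u x =
      ((2 ^ (κ - n - m - 3) * jacobiProduct m n d e d' e' ((1 + x) / 2) : ℝ) : ℂ) := by
  have h1 : 0 < (1 + x) / 2 := by linarith [hx.1]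
  have h2 : 0 < (1 - x) / 2 := by linarith [hx.2]
  rw [orthIntegrand, hypPoly_eq_jacobiPolynomial hη hs, hypPoly_eq_jacobiPolynomial hη' hs', hδ, hη,
    hδ', hη',
    show (1 - (x : ℂ)) ^ (((d : ℂ) + d' - 2) / 2) =
      ((((2 * ((1 - x) / 2)) ^ ((d + d') / 2 - 1) : ℝ)) : ℂ) by
        rw [Complex.ofReal_cpow (by positivity)]; congr 1 <;> push_cast <;> ring,
    show (1 + (x : ℂ)) ^ (((e : ℂ) + e' - 2) / 2) =
      ((((2 * ((1 + x) / 2)) ^ ((e + e') / 2 - 1) : ℝ)) : ℂ) by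
        rw [Complex.ofReal_cpow (by positivity)]; congr 1 <;> push_cast <;> ring,
    Real.mul_rpow two_pos.le h2.le, Real.mul_rpow two_pos.le h1.le, jacobiProduct,
    show κ - n - m - 3 = ((d + d') / 2 - 1) + ((e + e') / 2 - 1) by linarith,
    Real.rpow_add two_pos, show 1 - (1 + x) / 2 = (1 - x) / 2 by ring, Polynomial.eval_mul]
  push_cast
  ring

theorem phi_eq (hδ : deltaFn α z = d) (hη : etaFn β z = e)
    (hs : d + e = κ - 2 * n - 1) {x : ℝ} (hx : x ∈ Ioo (-1 : ℝ) 1) :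
    phi α β κ n z x = ((((1 - x) / 2) ^ (-(α - d + 1) / 2) * ((1 + x) / 2) ^ (-(β - e + 1) / 2) *
      (jacobiPolynomial n e d).eval ((1 + x) / 2) : ℝ) : ℂ) := by
  have h1 : 0 < (1 + x) / 2 := by linarith [hx.1]
  have h2 : 0 < (1 - x) / 2 := by linarith [hx.2]
  rw [phi, hypPoly_eq_jacobiPolynomial hη hs, hδ, hη]
  push_cast [Complex.ofReal_cpow h1.le, Complex.ofReal_cpow h2.le]
  rfl

theorem phi_mul_conj_phi_mul_weight (hδ : deltaFn α z = d) (hη : etaFn β z = e)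
    (hδ' : deltaFn α u = d') (hη' : etaFn β u = e')
    (hs : d + e = κ - 2 * m - 1) (hs' : d' + e' = κ - 2 * n - 1) {x : ℝ} (hx : x ∈ Ioo (-1 : ℝ) 1) :
    phi α β κ m z x * (starRingEnd ℂ) (phi α β κ n u x) * (jacobiWeight α β x : ℂ) =
      ((constD α β / 8 * jacobiProduct m n d e d' e' ((1 + x) / 2) : ℝ) : ℂ) := by
  have h1 : 0 < (1 + x) / 2 := by linarith [hx.1]
  have h2 : 0 < (1 - x) / 2 := by linarith [hx.2]
  rw [phi_eq hδ hη hs hx, phi_eq hδ' hη' hs' hx, Complex.conj_ofReal, ← Complex.ofReal_mul,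
    ← Complex.ofReal_mul]
  congr 1
  rw [jacobiWeight, jacobiProduct, constD, show (1 - x) ^ α = (2 * ((1 - x) / 2)) ^ α by
    congr 1; ring, show (1 + x) ^ β = (2 * ((1 + x) / 2)) ^ β by congr 1; ring,
    Real.mul_rpow two_pos.le h2.le, Real.mul_rpow two_pos.le h1.le,
    show 1 - (1 + x) / 2 = (1 - x) / 2 by ring,
    show (e + e') / 2 - 1 = -(β - e + 1) / 2 + -(β - e' + 1) / 2 + β by ring,
    show (d + d') / 2 - 1 = -(α - d + 1) / 2 + -(α - d' + 1) / 2 + α by ring,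
    Real.rpow_add h1, Real.rpow_add h1, Real.rpow_add h2, Real.rpow_add h2, Polynomial.eval_mul]
  -- This 1/2, with the Gamma quotient D/4 in the weight, gives the constant D/8.
  have h3 : (2 : ℝ) ^ (-α - β - 1) * 2 ^ α * 2 ^ β = 1 / 2 := by
    rw [← Real.rpow_add two_pos, ← Real.rpow_add two_pos,
      show -α - β - 1 + α + β = -1 by ring, Real.rpow_neg_one]
    norm_num
  linear_combination (((1 - x) / 2) ^ (-(α - d + 1) / 2) * ((1 + x) / 2) ^ (-(β - e + 1) / 2) *
    (jacobiPolynomial m e d).eval ((1 + x) / 2) *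
    (((1 - x) / 2) ^ (-(α - d' + 1) / 2) * ((1 + x) / 2) ^ (-(β - e' + 1) / 2) *
      (jacobiPolynomial n e' d').eval ((1 + x) / 2)) *
    (Real.Gamma (α + β + 2) / (Real.Gamma (α + 1) * Real.Gamma (β + 1))) *
    ((1 - x) / 2) ^ α * ((1 + x) / 2) ^ β) * h3

theorem measurable_jacobiWeight (α β : ℝ) : Measurable (jacobiWeight α β) := by
  unfold jacobiWeight
  fun_prop

theorem jacobiWeight_nonneg (hα : -1 < α) (hβ : -1 < β) {x : ℝ} (hx : x ∈ Ioo (-1 : ℝ) 1) :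
    0 ≤ jacobiWeight α β x := by
  have h1 : 0 ≤ 1 + x := by linarith [hx.1]
  have h2 : 0 ≤ 1 - x := by linarith [hx.2]
  have h3 := Real.Gamma_pos_of_pos (show 0 < α + 1 by linarith)
  have h4 := Real.Gamma_pos_of_pos (show 0 < β + 1 by linarith)
  have h5 := Real.Gamma_pos_of_pos (show 0 < α + β + 2 by linarith)
  unfold jacobiWeight
  positivity

theorem memLp_phi (hα : -1 < α) (hβ : -1 < β) (hd : 0 < d) (he : 0 < e)
    (hδ : deltaFn α z = d) (hη : etaFn β z = e) (hs : d + e = κ - 2 * n - 1) :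
    MemLp (phi α β κ n z) 2 (jacobiMeasure α β) := by
  have hmeas : Measurable (phi α β κ n z) := by
    have : hypPoly β κ n z = fun x =>
        (((jacobiPolynomial n e d).eval ((1 + x) / 2) : ℝ) : ℂ) :=
      funext (hypPoly_eq_jacobiPolynomial hη hs)
    unfold phi
    rw [this]
    have hP : Measurable fun x : ℝ => (jacobiPolynomial n e d).eval ((1 + x) / 2) :=
      ((jacobiPolynomial n e d).continuous.comp (by fun_prop)).measurable
    fun_prop
  rw [memLp_two_iff_integrable_sq_norm hmeas.aestronglyMeasurable, jacobiMeasure,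
    integrable_withDensity_iff (measurable_jacobiWeight α β).ennreal_ofReal
      (Eventually.of_forall fun _ => ENNReal.ofReal_lt_top)]
  -- |φ|² w is the diagonal product up to a constant, integrable since d, e > 0.
  have hint := ((intervalIntegrable_jacobiProduct hd he hd he n n).comp_one_add_div_two).const_mul
    (constD α β / 8)
  rw [intervalIntegrable_iff_integrableOn_Ioo_of_le (by norm_num)] at hint
  refine hint.congr_fun (fun x hx => ?_) measurableSet_Ioo
  have h := phi_mul_conj_phi_mul_weight hδ hη hδ hη hs hs hx
  rw [Complex.mul_conj, Complex.normSq_eq_norm_sq, ← Complex.ofReal_mul] at h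
  simp only
  rw [ENNReal.toReal_ofReal (jacobiWeight_nonneg hα hβ hx)]
  exact (Complex.ofReal_injective h).symm

theorem integral_congr_Ioo {E : Type*} [NormedAddCommGroup E] [NormedSpace ℝ E] {a b : ℝ}
    (hab : a ≤ b) {f g : ℝ → E} (h : ∀ x ∈ Ioo a b, f x = g x) :
    ∫ x in a..b, f x = ∫ x in a..b, g x := by
  rw [intervalIntegral.integral_of_le hab, intervalIntegral.integral_of_le hab,
    integral_Ioc_eq_integral_Ioo, integral_Ioc_eq_integral_Ioo]
  exact setIntegral_congr_fun measurableSet_Ioo h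

theorem phi_orthogonality (hα : -1 < α) (hαβ : α ≤ β)
    (hm : IsLambda α β κ m z) (hz : z ≠ -((α : ℂ) + 1) ^ 2)
    (hn : IsLambda α β κ n u) (hu : u ≠ -((α : ℂ) + 1) ^ 2) :
    MemLp (phi α β κ m z) 2 (jacobiMeasure α β) ∧
      MemLp (phi α β κ n u) 2 (jacobiMeasure α β) ∧
      jacobiInner α β (phi α β κ m z) (phi α β κ n u) =
        (if m = n then (constD α β : ℂ) / normConst α β κ n u else 0) ∧
      IntervalIntegrable (orthIntegrand α β κ m n z u) volume (-1) 1 ∧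
      ∫ x in (-1 : ℝ)..1, orthIntegrand α β κ m n z u x =
        (if m = n then (2 : ℂ) ^ ((κ : ℂ) - n - m) / normConst α β κ n u else 0) := by
  obtain ⟨d, e, hd, he, hδ, hη, hs, hsq, -⟩ := hm.exists_real hα hαβ hz
  obtain ⟨d', e', hd', he', hδ', hη', hs', hsq', -⟩ := hn.exists_real hα hαβ hu
  have hI := integral_jacobiProduct hd he hd' he' hδ' hη' hs hs' hsq hsq'
  have hβ : -1 < β := by linarith
  refine ⟨memLp_phi hα hβ hd he hδ hη hs, memLp_phi hα hβ hd' he' hδ' hη' hs', ?_, ?_, ?_⟩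
  · rw [jacobiInner, integral_congr_Ioo (by norm_num) fun x hx =>
      phi_mul_conj_phi_mul_weight hδ hη hδ' hη' hs hs' hx, intervalIntegral.integral_ofReal,
      intervalIntegral.integral_const_mul, integral_comp_one_add_div_two, Complex.ofReal_mul,
      Complex.ofReal_mul, hI]
    split_ifs <;> push_cast <;> ring
  · have h := ((intervalIntegrable_jacobiProduct hd he hd' he' m n).comp_one_add_div_two).const_mul
      (2 ^ (κ - n - m - 3))
    rw [intervalIntegrable_iff_integrableOn_Ioo_of_le (by norm_num)] at h ⊢
    have h' : IntegrableOn _ _ _ := h.ofReal (𝕜 := ℂ)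
    exact h'.congr_fun (fun x hx => (orthIntegrand_eq hδ hη hδ' hη' hs hs' hx).symm)
      measurableSet_Ioo
  · rw [integral_congr_Ioo (by norm_num) fun x hx =>
      orthIntegrand_eq hδ hη hδ' hη' hs hs' hx, intervalIntegral.integral_ofReal,
      intervalIntegral.integral_const_mul, integral_comp_one_add_div_two, Complex.ofReal_mul,
      Complex.ofReal_mul, hI]
    -- The 8 is the factor 2 from dx = 2 dt times the 4 in 4/N.
    have h2 : (((2 : ℝ) ^ (κ - n - m - 3) : ℝ) : ℂ) * 8 = (2 : ℂ) ^ ((κ : ℂ) - n - m) := by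
      have : (2 : ℝ) ^ (κ - n - m - 3) * 8 = 2 ^ (κ - n - m) := by
        rw [Real.rpow_sub two_pos (κ - n - m) 3]
        norm_num
      rw [show (8 : ℂ) = ((8 : ℝ) : ℂ) by norm_num, ← Complex.ofReal_mul, this,
        Complex.ofReal_cpow two_pos.le]
      push_cast; rfl
    split_ifs
    · rw [← h2]; push_cast; ring
    · simp

end Orthogonality

theorem corollary2p4 (α β κ : ℝ) (hα : -1 < α) (hαβ : α ≤ β) (hκ : 1 ≤ κ) :
    -- the solutions `λ_n` other than the endpoint `-(α+1)²` of the continuous spectrum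
    (∀ (n : ℕ) (z : ℂ),
      (IsLambda α β κ n z ∧ z ≠ -((α : ℂ) + 1) ^ 2) ↔
        (√((β - α) * (α + β + 2)) < κ - 2 * n - 1 ∧
          z = (((-n + (κ - 1) / 2 + (α - β) * (α + β + 2) / (-4 * n - 2 + 2 * κ)) ^ 2
            - (α + 1) ^ 2 : ℝ) : ℂ))) ∧
    -- the constants `N_{λ_n}`
    (∀ (n : ℕ) (z : ℂ), (n : ℝ) ≤ (κ - 1) / 2 →
      IsLambda α β κ n z → z ≠ -((α : ℂ) + 1) ^ 2 → (∀ k : ℕ, etaFn β z ≠ k) →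
        HasSimpleResidue (cQuotient α β κ) z (normConst α β κ n z) ∧
        normConst α β κ n z = normConstGamma α β κ n z) ∧
    -- the orthogonality relations, in `H` and written out
    (∀ (m n : ℕ) (z u : ℂ), (m : ℝ) ≤ (κ - 1) / 2 → (n : ℝ) ≤ (κ - 1) / 2 →
      IsLambda α β κ m z → z ≠ -((α : ℂ) + 1) ^ 2 →
      IsLambda α β κ n u → u ≠ -((α : ℂ) + 1) ^ 2 →
        MemLp (phi α β κ m z) 2 (jacobiMeasure α β) ∧
        MemLp (phi α β κ n u) 2 (jacobiMeasure α β) ∧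
        jacobiInner α β (phi α β κ m z) (phi α β κ n u) =
          (if m = n then (constD α β : ℂ) / normConst α β κ n u else 0) ∧
        IntervalIntegrable (orthIntegrand α β κ m n z u) volume (-1) 1 ∧
        ∫ x in (-1 : ℝ)..1, orthIntegrand α β κ m n z u x =
          (if m = n then (2 : ℂ) ^ ((κ : ℂ) - n - m) / normConst α β κ n u else 0)) := by
  refine ⟨fun n z => isLambda_iff hα hαβ, fun n z _ h hz hη => ?_,
    fun m n z u _ _ hm hz hn hu => phi_orthogonality hα hαβ hm hz hn hu⟩
  have h1 := normConst_eq_normConstGamma hα hαβ h hz hη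
  exact ⟨h1 ▸ hasSimpleResidue_cQuotient hα hαβ h hz hη, h1⟩
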